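/- Let $(\Omega,\mathcal F)$ be a measurable space, $T:\Omega\to\Omega$ a measurable map and $\mathcal I=\{A\in\mathcal F: T^{-1}A=A\}$. A capacity on $\mathcal F$ is a set function $\mu:\mathcal F\to[0,1]$ with $\mu(\emptyset)=0$, $\mu(\Omega)=1$ and $\mu(A)\le\mu(B)$ whenever $A\subseteq B$; its core, $\operatorname{core}(\mu)$, is the set of all finitely additive capacities $P$ on $\mathcal F$ with $P(A)\le\mu(A)$ for all $A\in\mathcal F$. An upper probability is a capacity $V$ for which there is a set $\Lambda$ of (countably additive) probabilities on $\mathcal F$, compact in the topology of setwise convergence on $\mathcal F$, such that $V(A)=\max_{P\in\Lambda}P(A)$ for all $A\in\mathcal F$. A capacity $\mu$ is $T$-invariant if $\mu(T^{-1}A)=\mu(A)$ for all $A\in\mathcal F$, and a $T$-invariant capacity $\mu$ is ergodic if for every $A\in\mathcal I$ both $\mu(A)\in\{0,1\}$, and $\mu(A)=0$ or $\mu(\Omega\setminus A)=0$. **Theorem.** Let $V$ be a $T$-invariant upper probability on $(\Omega,\mathcal F)$. Then $V$ is ergodic if and only if there exists a $T$-invariant ergodic probability $Q\in\operatorname{core}(V)$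 such that for every $P\in\operatorname{core}(V)$, $$P(A)=Q(A)\quad\text{for all }A\in\mathcal I.$$ Moreover, in this case such a $Q$ is unique; that is, $V$ is ergodic if and only if there exists a unique such $Q$. -/

import Mathlib

open MeasureTheory Set

/-- Real-valued set functions on the σ-algebra of `Ω`. Being functions on the type of measurable
sets, they carry the product topology, that is, the topology of setwise convergence
`P_α(A) → P(A)` for every measurable `A` (the weak* topology). -/
abbrev SetFun (Ω : Type*) [MeasurableSpace Ω] : Type _ :=
  {A : Set Ω // MeasurableSet A} → ℝ

/-- The set function `A ↦ P(A)` of a (countably additive) probability measure `P`. -/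
def probSetFun {Ω : Type*} [MeasurableSpace Ω] (P : ProbabilityMeasure Ω) : SetFun Ω :=
  fun A => (P : Measure Ω).real (A : Set Ω)

/-- Capacities: normalized monotone set functions. Their values are automatically in `[0,1]`. -/
structure IsCapacity {Ω : Type*} [MeasurableSpace Ω] (μ : SetFun Ω) : Prop where
  empty : μ ⟨∅, MeasurableSet.empty⟩ = 0
  univ : μ ⟨Set.univ, MeasurableSet.univ⟩ = 1
  mono : ∀ A B : {A : Set Ω // MeasurableSet A}, (A : Set Ω) ⊆ B → μ A ≤ μ B

/-- Finite additivity of a set function. -/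
def IsAdditive {Ω : Type*} [MeasurableSpace Ω] (μ : SetFun Ω) : Prop :=
  ∀ A B : {A : Set Ω // MeasurableSet A}, Disjoint (A : Set Ω) B →
    μ ⟨(A : Set Ω) ∪ B, A.2.union B.2⟩ = μ A + μ B

/-- The core of a set function: all finitely additive capacities dominated by it. -/
def core {Ω : Type*} [MeasurableSpace Ω] (μ : SetFun Ω) : Set (SetFun Ω) :=
  {P | IsCapacity P ∧ IsAdditive P ∧ ∀ A, P A ≤ μ A}

/-- Upper probabilities: capacities that are the setwise maximum of a weak* compact set of
countably additive probabilities. -/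
def IsUpperProbability {Ω : Type*} [MeasurableSpace Ω] (V : SetFun Ω) : Prop :=
  IsCapacity V ∧ ∃ Λ : Set (SetFun Ω), Λ ⊆ range probSetFun ∧ IsCompact Λ ∧
    ∀ A, IsGreatest ((fun P : SetFun Ω => P A) '' Λ) (V A)

/-- `T`-invariance of a set function: `μ(T⁻¹A) = μ(A)` for every measurable `A`. -/
def IsInvariantSetFun {Ω : Type*} [MeasurableSpace Ω] {T : Ω → Ω} (hT : Measurable T)
    (μ : SetFun Ω) : Prop :=
  ∀ A : {A : Set Ω // MeasurableSet A}, μ ⟨T ⁻¹' (A : Set Ω), hT A.2⟩ = μ A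

/-- Ergodicity of a (`T`-invariant) capacity: for every measurable `A` with `T⁻¹A = A`, one has
`μ(A) ∈ {0,1}`, and `μ(A) = 0` or `μ(Aᶜ) = 0`. -/
def IsErgodicCapacity {Ω : Type*} [MeasurableSpace Ω] (T : Ω → Ω) (μ : SetFun Ω) : Prop :=
  ∀ A : {A : Set Ω // MeasurableSet A}, MeasurableSet[MeasurableSpace.invariants T] (A : Set Ω) →
    (μ A = 0 ∨ μ A = 1) ∧ (μ A = 0 ∨ μ ⟨(A : Set Ω)ᶜ, A.2.compl⟩ = 0)

/-- `Q` is an ergodic `T`-invariant probability in the core of `V`, and every element of the core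
of `V` agrees with `Q` on the σ-algebra of `T`-invariant measurable sets. -/
def IsInvariantSkeleton {Ω : Type*} [MeasurableSpace Ω] (T : Ω → Ω) (V : SetFun Ω)
    (Q : ProbabilityMeasure Ω) : Prop :=
  Ergodic T (Q : Measure Ω) ∧ probSetFun Q ∈ core V ∧
    ∀ P ∈ core V, ∀ A : {A : Set Ω // MeasurableSet A},
      MeasurableSet[MeasurableSpace.invariants T] (A : Set Ω) → P A = probSetFun Q A

section

open Filter Topology

variable {Ω : Type*} [MeasurableSpace Ω]

/-! If `V` is ergodic, then for invariant `A` one of `A`, `Aᶜ` is `V`-null, hence null for the whole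
core; so all core elements agree on invariant sets, and it remains to find an invariant probability
among them. The core is convex, compact and stable under push-forward by `T`, so a limit of Cesàro
averages is invariant (`exists_invariant_mem_core`); domination by `V`, continuous at `∅`, makes it
countably additive (`IsUpperProbability.exists_probSetFun_eq`). Conversely, `V A` is attained in the
core, so `V = Q` on invariant sets and inherits the zero-one law. Uniqueness holds because invariant
sets determine an ergodic probability (`Ergodic.eq_of_forall_invariant`). -/

theorem isCapacity_probSetFun (P : ProbabilityMeasure Ω) : IsCapacity (probSetFun P) where
  empty := by simp [probSetFun]
  univ := by simp [probSetFun]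
  mono _ _ h := measureReal_mono h

theorem isAdditive_probSetFun (P : ProbabilityMeasure Ω) : IsAdditive (probSetFun P) :=
  fun _ B h => measureReal_union h B.2

theorem IsCapacity.nonneg {μ : SetFun Ω} (hμ : IsCapacity μ) (A : {A : Set Ω // MeasurableSet A}) :
    0 ≤ μ A :=
  hμ.empty ▸ hμ.mono _ _ (empty_subset _)

theorem IsCapacity.le_one {μ : SetFun Ω} (hμ : IsCapacity μ) (A : {A : Set Ω // MeasurableSet A}) :
    μ A ≤ 1 :=
  hμ.univ ▸ hμ.mono _ _ (subset_univ _)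

theorem IsAdditive.add_compl {μ : SetFun Ω} (hμ : IsCapacity μ) (ha : IsAdditive μ)
    (A : {A : Set Ω // MeasurableSet A}) : μ A + μ ⟨(A : Set Ω)ᶜ, A.2.compl⟩ = 1 := by
  rw [← ha A ⟨(A : Set Ω)ᶜ, A.2.compl⟩ disjoint_compl_right, ← hμ.univ]
  congr 2
  exact union_compl_self _

theorem IsUpperProbability.exists_mem_core_eq {V : SetFun Ω} (hV : IsUpperProbability V)
    (A : {A : Set Ω // MeasurableSet A}) :
    ∃ P : ProbabilityMeasure Ω, probSetFun P ∈ core V ∧ probSetFun P A = V A := by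
  obtain ⟨-, Λ, hΛ, -, hmax⟩ := hV
  obtain ⟨p, hp, hpA⟩ := (hmax A).1
  obtain ⟨P, rfl⟩ := hΛ hp
  exact ⟨P, ⟨isCapacity_probSetFun P, isAdditive_probSetFun P,
    fun B => (hmax B).2 (mem_image_of_mem _ hp)⟩, hpA⟩

/-- An upper probability is continuous from above at the empty set. -/
theorem IsUpperProbability.tendsto_zero {V : SetFun Ω} (hV : IsUpperProbability V)
    {s : ℕ → {A : Set Ω // MeasurableSet A}} (hs : Antitone s)
    (hs' : ⋂ n, (s n : Set Ω) = ∅) : Tendsto (fun n => V (s n)) atTop (𝓝 0) := by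
  obtain ⟨-, Λ, hΛ, hc, hmax⟩ := hV
  -- Dini's theorem: evaluations at `s n` are continuous and decrease pointwise to `0` on the
  -- compact `Λ`. Uniformity then controls their maximum `V (s n)`.
  have hu : TendstoUniformlyOn (fun n (P : SetFun Ω) => P (s n)) (fun _ => 0) atTop Λ := by
    refine Antitone.tendstoUniformlyOn_of_forall_tendsto hc
      (fun n => (continuous_apply (s n)).continuousOn) ?_ continuousOn_const ?_
    · intro p hp m n hmn
      obtain ⟨P, rfl⟩ := hΛ hp
      exact (isCapacity_probSetFun P).mono _ _ (hs hmn)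
    · intro p hp
      obtain ⟨P, rfl⟩ := hΛ hp
      have h := tendsto_measure_iInter_atTop (μ := (P : Measure Ω))
        (fun n => (s n).2.nullMeasurableSet) hs ⟨0, measure_ne_top _ _⟩
      rw [hs', measure_empty] at h
      exact (ENNReal.tendsto_toReal ENNReal.zero_ne_top).comp h
  rw [Metric.tendstoUniformlyOn_iff] at hu
  rw [Metric.tendsto_nhds]
  intro ε hε
  filter_upwards [hu ε hε] with n hn
  obtain ⟨p, hp, hpn⟩ := (hmax (s n)).1
  rw [← hpn, dist_comm]
  exact hn p hp

/-- Every element of the core of an upper probability is countably additive. -/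
theorem IsUpperProbability.exists_probSetFun_eq {V : SetFun Ω} (hV : IsUpperProbability V)
    {q : SetFun Ω} (hq : q ∈ core V) : ∃ Q : ProbabilityMeasure Ω, probSetFun Q = q := by
  classical
  obtain ⟨hcap, hadd, hle⟩ := hq
  have hring : IsSetRing {A : Set Ω | MeasurableSet A} :=
    ⟨MeasurableSet.empty, fun _ _ => MeasurableSet.union, fun _ _ => MeasurableSet.diff⟩
  let f : Set Ω → ENNReal := fun A => if h : MeasurableSet A then ENNReal.ofReal (q ⟨A, h⟩) else 0
  have hf : ∀ A (h : MeasurableSet A), f A = ENNReal.ofReal (q ⟨A, h⟩) := fun A h => dif_pos h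
  let m : AddContent ENNReal {A : Set Ω | MeasurableSet A} :=
    hring.addContent_of_union f (by rw [hf _ MeasurableSet.empty, hcap.empty, ENNReal.ofReal_zero])
      (fun {A B} (hA : MeasurableSet A) (hB : MeasurableSet B) hAB => by
        rw [hf _ hA, hf _ hB, hf _ (hA.union hB), ← ENNReal.ofReal_add (hcap.nonneg _)
          (hcap.nonneg _), ← hadd ⟨A, hA⟩ ⟨B, hB⟩ hAB])
  have hm : ∀ A (h : MeasurableSet A), m A = ENNReal.ofReal (q ⟨A, h⟩) := hf
  let Q : Measure Ω := Measure.ofMeasurable (fun A _ => m A) addContent_empty fun s hs hd =>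
    addContent_iUnion_eq_sum_of_tendsto_zero hring m
      (fun A hA => by rw [hm A hA]; exact ENNReal.ofReal_ne_top)
      -- Continuity at `∅` passes from `V` to `q` since `0 ≤ q ≤ V`.
      (fun t ht hanti hemp => by
        have h0 : Tendsto (fun n => q ⟨t n, ht n⟩) atTop (𝓝 0) :=
          squeeze_zero (fun n => hcap.nonneg _) (fun n => hle _)
            (hV.tendsto_zero (s := fun n => ⟨t n, ht n⟩) (fun _ _ h => hanti h) hemp)
        simpa [hm _ (ht _)] using ENNReal.tendsto_ofReal h0)
      hs (MeasurableSet.iUnion hs) hd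
  have hQ : ∀ A : {A : Set Ω // MeasurableSet A}, Q A = ENNReal.ofReal (q A) := fun A =>
    (Measure.ofMeasurable_apply _ A.2).trans (hm _ A.2)
  have : IsProbabilityMeasure Q :=
    ⟨by rw [hQ ⟨univ, MeasurableSet.univ⟩, hcap.univ, ENNReal.ofReal_one]⟩
  refine ⟨⟨Q, this⟩, funext fun A => ?_⟩
  change (Q A).toReal = q A
  rw [hQ A, ENNReal.toReal_ofReal (hcap.nonneg A)]

/-- Each defining condition involves finitely many evaluations; countable additivity would not be of
this kind. -/
theorem isClosed_core (V : SetFun Ω) : IsClosed (core V) := by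
  have h : core V = {P | P ⟨∅, MeasurableSet.empty⟩ = 0} ∩ {P | P ⟨univ, MeasurableSet.univ⟩ = 1} ∩
      (⋂ (A : {A : Set Ω // MeasurableSet A}) (B : {A : Set Ω // MeasurableSet A})
        (_ : (A : Set Ω) ⊆ B), {P | P A ≤ P B}) ∩
      (⋂ (A : {A : Set Ω // MeasurableSet A}) (B : {A : Set Ω // MeasurableSet A})
        (_ : Disjoint (A : Set Ω) B),
        {P | P ⟨(A : Set Ω) ∪ B, A.2.union B.2⟩ = P A + P B}) ∩
      ⋂ A, {P | P A ≤ V A} := by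
    ext P
    simp only [mem_inter_iff, mem_iInter, mem_ofPred_eq, core]
    exact ⟨fun ⟨h₁, h₂, h₃⟩ => ⟨⟨⟨⟨h₁.1, h₁.2⟩, h₁.3⟩, h₂⟩, h₃⟩,
      fun ⟨⟨⟨⟨h₁, h₂⟩, h₃⟩, h₄⟩, h₅⟩ => ⟨⟨h₁, h₂, h₃⟩, h₄, h₅⟩⟩
  rw [h]
  refine (((IsClosed.inter ?_ ?_).inter ?_).inter ?_).inter ?_
  · exact isClosed_eq (by fun_prop) (by fun_prop)
  · exact isClosed_eq (by fun_prop) (by fun_prop)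
  · exact isClosed_iInter fun A => isClosed_iInter fun B => isClosed_iInter fun _ =>
      isClosed_le (by fun_prop) (by fun_prop)
  · exact isClosed_iInter fun A => isClosed_iInter fun B => isClosed_iInter fun _ =>
      isClosed_eq (by fun_prop) (by fun_prop)
  · exact isClosed_iInter fun A => isClosed_le (by fun_prop) (by fun_prop)

theorem isCompact_core (V : SetFun Ω) : IsCompact (core V) :=
  (isCompact_univ_pi fun _ => isCompact_Icc (a := (0 : ℝ)) (b := 1)).of_isClosed_subset
    (isClosed_core V) fun _ hP A _ => ⟨hP.1.nonneg A, hP.1.le_one A⟩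

theorem convex_core (V : SetFun Ω) : Convex ℝ (core V) := by
  intro P hP Q hQ a b ha hb hab
  refine ⟨⟨?_, ?_, fun A B h => ?_⟩, fun A B h => ?_, fun A => ?_⟩
  · rw [Pi.add_apply, Pi.smul_apply, Pi.smul_apply, hP.1.empty, hQ.1.empty, smul_zero, smul_zero,
      add_zero]
  · rw [Pi.add_apply, Pi.smul_apply, Pi.smul_apply, hP.1.univ, hQ.1.univ, smul_eq_mul, smul_eq_mul,
      mul_one, mul_one, hab]
  · have h₁ := hP.1.mono A B h
    have h₂ := hQ.1.mono A B h
    simp only [Pi.add_apply, Pi.smul_apply, smul_eq_mul]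
    gcongr
  · simp only [Pi.add_apply, Pi.smul_apply, smul_eq_mul, hP.2.1 A B h, hQ.2.1 A B h]
    ring
  · have h₁ := mul_le_mul_of_nonneg_left (hP.2.2 A) ha
    have h₂ := mul_le_mul_of_nonneg_left (hQ.2.2 A) hb
    simp only [Pi.add_apply, Pi.smul_apply, smul_eq_mul]
    calc a * P A + b * Q A ≤ a * V A + b * V A := add_le_add h₁ h₂
      _ = V A := by rw [← add_mul, hab, one_mul]

/-- The image of a set function under a measurable map. -/
def SetFun.map {T : Ω → Ω} (hT : Measurable T) (P : SetFun Ω) : SetFun Ω :=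
  fun A => P ⟨T ⁻¹' (A : Set Ω), hT A.2⟩

theorem map_mem_core {T : Ω → Ω} (hT : Measurable T) {V : SetFun Ω} (hinv : IsInvariantSetFun hT V)
    {P : SetFun Ω} (hP : P ∈ core V) : P.map hT ∈ core V :=
  ⟨⟨hP.1.empty, hP.1.univ, fun _ _ h => hP.1.mono _ _ (preimage_mono h)⟩,
    fun A B h => hP.2.1 ⟨_, hT A.2⟩ ⟨_, hT B.2⟩ (h.preimage T), fun A => (hP.2.2 _).trans_eq (hinv A)⟩

/-- If `V` is invariant, then the core of `V` contains an invariant set function as soon as it is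
nonempty. -/
theorem exists_invariant_mem_core {T : Ω → Ω} (hT : Measurable T) {V : SetFun Ω}
    (hinv : IsInvariantSetFun hT V) {P : SetFun Ω} (hP : P ∈ core V) :
    ∃ Q ∈ core V, IsInvariantSetFun hT Q := by
  let p : ℕ → SetFun Ω := fun k => (SetFun.map hT)^[k] P
  have hp : ∀ k, p k ∈ core V := fun k => by
    induction k with
    | zero => exact hP
    | succ k ih =>
      change (SetFun.map hT)^[k + 1] P ∈ core V
      rw [Function.iterate_succ_apply']
      exact map_mem_core hT hinv ih
  have hsucc : ∀ k (A : {A : Set Ω // MeasurableSet A}),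
      p k ⟨T ⁻¹' (A : Set Ω), hT A.2⟩ = p (k + 1) A := fun k A =>
    (congrFun (Function.iterate_succ_apply' (SetFun.map hT) k P) A).symm
  let c : ℕ → SetFun Ω := fun n => ∑ k ∈ Finset.range (n + 1), ((n : ℝ) + 1)⁻¹ • p k
  have hc : ∀ n, c n ∈ core V := fun n => by
    refine (convex_core V).sum_mem (fun _ _ => by positivity) ?_ fun k _ => hp k
    rw [Finset.sum_const, Finset.card_range, nsmul_eq_mul]
    push_cast
    exact mul_inv_cancel₀ (by positivity)
  -- The averages telescope, so their invariance defect is at most `1 / (n + 1)`.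
  have hdiff : ∀ n (A : {A : Set Ω // MeasurableSet A}),
      c n ⟨T ⁻¹' (A : Set Ω), hT A.2⟩ - c n A = ((n : ℝ) + 1)⁻¹ * (p (n + 1) A - p 0 A) := by
    intro n A
    simp only [c, Finset.sum_apply, Pi.smul_apply, smul_eq_mul, hsucc, ← Finset.mul_sum,
      ← mul_sub, ← Finset.sum_sub_distrib]
    rw [Finset.sum_range_sub (fun k => p k A)]
  -- An ultrafilter limit is used because a compact product need not be sequentially compact.
  obtain ⟨Q, hQ, hlim⟩ := (isCompact_core V).ultrafilter_le_nhds
    ((hyperfilter ℕ).map c) (le_principal_iff.2 (show ∀ᶠ n in hyperfilter ℕ, c n ∈ core V from Eventually.of_forall hc))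
  replace hlim : Tendsto c (hyperfilter ℕ) (𝓝 Q) := hlim
  rw [tendsto_pi_nhds] at hlim
  refine ⟨Q, hQ, fun A => sub_eq_zero.1 (tendsto_nhds_unique ((hlim _).sub (hlim A)) ?_)⟩
  refine Tendsto.mono_left ?_ Nat.hyperfilter_le_atTop
  simp only [hdiff]
  have h0 : Tendsto (fun n : ℕ => ((n : ℝ) + 1)⁻¹) atTop (𝓝 0) := by
    simpa using tendsto_one_div_add_atTop_nhds_zero_nat (𝕜 := ℝ)
  refine squeeze_zero_norm (fun n => ?_) h0
  rw [norm_mul, Real.norm_of_nonneg (by positivity : (0 : ℝ) ≤ ((n : ℝ) + 1)⁻¹)]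
  refine mul_le_of_le_one_right (by positivity) ?_
  rw [Real.norm_eq_abs, abs_le]
  constructor <;> linarith [(hp 0).1.nonneg A, (hp 0).1.le_one A, (hp (n + 1)).1.nonneg A,
    (hp (n + 1)).1.le_one A]

/-- Two ergodic probabilities that agree on the strictly invariant measurable sets are equal. -/
theorem Ergodic.eq_of_forall_invariant {T : Ω → Ω} {μ ν : Measure Ω} [IsProbabilityMeasure μ]
    [IsProbabilityMeasure ν] (hμ : Ergodic T μ) (hν : Ergodic T ν)
    (h : ∀ A, MeasurableSet A → T ⁻¹' A = A → μ A = ν A) : μ = ν := by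
  -- On invariant sets `μ` and `ν` have the same null sets, so the dichotomy for `μ` carries over to
  -- the sum.
  have hsum : Ergodic T (μ + ν) :=
    { toMeasurePreserving := ⟨hμ.measurable, by
        rw [Measure.map_add _ _ hμ.measurable, hμ.map_eq, hν.map_eq]⟩
      aeconst_set := fun A hA hTA => by
        rw [eventuallyConst_set']
        simp only [ae_eq_empty, ae_eq_univ, Measure.add_apply, add_eq_zero,
          ← h A hA hTA, ← h Aᶜ hA.compl (by rw [preimage_compl, hTA]), and_self]
        exact hμ.toPreErgodic.measure_self_or_compl_eq_zero hA hTA }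
  -- An invariant measure absolutely continuous with respect to an ergodic one is a multiple of it.
  obtain ⟨a, ha⟩ := hsum.eq_smul_of_absolutelyContinuous hμ.toMeasurePreserving
    (Measure.AbsolutelyContinuous.rfl.add_right ν)
  obtain ⟨b, hb⟩ := hsum.eq_smul_of_absolutelyContinuous hν.toMeasurePreserving
    (by rw [add_comm]; exact Measure.AbsolutelyContinuous.rfl.add_right μ)
  -- The sum has mass `2`, which fixes both scalars.
  have key : ∀ {ρ : Measure Ω} [IsProbabilityMeasure ρ] {r : ENNReal},
      ρ = r • (μ + ν) → r = 2⁻¹ := fun {ρ} _ {r} hr => by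
    have h1 := congrArg (fun ρ => ρ univ) hr
    simp only [Measure.smul_apply, Measure.add_apply, measure_univ, smul_eq_mul,
      one_add_one_eq_two] at h1
    exact ENNReal.eq_inv_of_mul_eq_one_left h1.symm
  calc μ = a • (μ + ν) := ha
    _ = b • (μ + ν) := by rw [key ha, key hb]
    _ = ν := hb.symm

/-- If `A` is `V`-null both values are `0`; if `Aᶜ` is, additivity makes both `1`. -/
theorem IsErgodicCapacity.eq_of_mem_core {T : Ω → Ω} {V : SetFun Ω} (hV : IsErgodicCapacity T V)
    {P Q : SetFun Ω} (hP : P ∈ core V) (hQ : Q ∈ core V) (A : {A : Set Ω // MeasurableSet A})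
    (hA : MeasurableSet[MeasurableSpace.invariants T] (A : Set Ω)) : P A = Q A := by
  have hP' := hP.2.1.add_compl hP.1 A
  have hQ' := hQ.2.1.add_compl hQ.1 A
  rcases (hV A hA).2 with h | h
  · linarith [hP.1.nonneg A, hQ.1.nonneg A, hP.2.2 A, hQ.2.2 A]
  · linarith [hP.1.nonneg ⟨_, A.2.compl⟩, hQ.1.nonneg ⟨_, A.2.compl⟩, hP.2.2 ⟨_, A.2.compl⟩,
      hQ.2.2 ⟨_, A.2.compl⟩]

theorem IsErgodicCapacity.exists_isInvariantSkeleton {T : Ω → Ω} (hT : Measurable T) {V : SetFun Ω}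
    (hV : IsUpperProbability V) (hinv : IsInvariantSetFun hT V) (herg : IsErgodicCapacity T V) :
    ∃ Q : ProbabilityMeasure Ω, IsInvariantSkeleton T V Q := by
  obtain ⟨P, hP, -⟩ := hV.exists_mem_core_eq ⟨univ, MeasurableSet.univ⟩
  obtain ⟨q, hq, hqinv⟩ := exists_invariant_mem_core hT hinv hP
  obtain ⟨Q, rfl⟩ := hV.exists_probSetFun_eq hq
  have hnull : ∀ A : {A : Set Ω // MeasurableSet A}, V A = 0 → (Q : Measure Ω) A = 0 :=
    fun A hA => (measureReal_eq_zero_iff).1 (le_antisymm (hA ▸ hq.2.2 A) measureReal_nonneg)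
  refine ⟨Q, ⟨⟨hT, Measure.ext fun A hA => ?_⟩, ⟨fun A hA hTA => ?_⟩⟩, hq,
    fun P hP A hA => herg.eq_of_mem_core hP hq A hA⟩
  · rw [Measure.map_apply hT hA]
    exact (measureReal_eq_measureReal_iff).1 (hqinv ⟨A, hA⟩)
  · rw [eventuallyConst_set', ae_eq_empty, ae_eq_univ]
    exact (herg ⟨A, hA⟩ ⟨hA, hTA⟩).2.imp (hnull _) (hnull _)

theorem IsInvariantSkeleton.isErgodicCapacity {T : Ω → Ω} {V : SetFun Ω}
    (hV : IsUpperProbability V) {Q : ProbabilityMeasure Ω} (hQ : IsInvariantSkeleton T V Q) :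
    IsErgodicCapacity T V := by
  obtain ⟨herg, -, heq⟩ := hQ
  have hVQ : ∀ A : {A : Set Ω // MeasurableSet A},
      MeasurableSet[MeasurableSpace.invariants T] (A : Set Ω) → V A = probSetFun Q A := by
    intro A hA
    obtain ⟨P, hP, hPA⟩ := hV.exists_mem_core_eq A
    rw [← hPA, heq _ hP A hA]
  intro A hA
  rw [hVQ A hA, hVQ ⟨_, A.2.compl⟩ hA.compl]
  constructor
  · refine (herg.toPreErgodic.prob_eq_zero_or_one A.2 hA.2).imp (fun h => ?_) fun h => ?_ <;>
      simp [probSetFun, measureReal_def, h]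
  · refine (herg.toPreErgodic.measure_self_or_compl_eq_zero A.2 hA.2).imp (fun h => ?_)
      fun h => ?_ <;> simp [probSetFun, measureReal_def, h]

theorem IsInvariantSkeleton.unique {T : Ω → Ω} {V : SetFun Ω} {P Q : ProbabilityMeasure Ω}
    (hP : IsInvariantSkeleton T V P) (hQ : IsInvariantSkeleton T V Q) : P = Q :=
  Subtype.ext <| Ergodic.eq_of_forall_invariant (μ := (P : Measure Ω)) (ν := (Q : Measure Ω))
    hP.1 hQ.1 fun A hA hTA =>
      (measureReal_eq_measureReal_iff (measure_ne_top _ _) (measure_ne_top _ _)).1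
        (hQ.2.2 _ hP.2.1 ⟨A, hA⟩ ⟨hA, hTA⟩)

end

theorem theorem3p2 {Ω : Type*} [MeasurableSpace Ω] {T : Ω → Ω} (hT : Measurable T)
    (V : SetFun Ω) (hV : IsUpperProbability V) (hinv : IsInvariantSetFun hT V) :
    (IsErgodicCapacity T V ↔ ∃ Q : ProbabilityMeasure Ω, IsInvariantSkeleton T V Q) ∧
    (IsErgodicCapacity T V ↔ ∃! Q : ProbabilityMeasure Ω, IsInvariantSkeleton T V Q) := by
  have h : IsErgodicCapacity T V ↔ ∃ Q : ProbabilityMeasure Ω, IsInvariantSkeleton T V Q :=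
    ⟨fun herg => herg.exists_isInvariantSkeleton hT hV hinv,
      fun ⟨_, hQ⟩ => hQ.isErgodicCapacity hV⟩
  exact ⟨h, h.trans ⟨fun ⟨Q, hQ⟩ => ⟨Q, hQ, fun _ hP => hP.unique hQ⟩, ExistsUnique.exists⟩⟩
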